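/- Let $R$ be a commutative ring with an ideal $\mathfrak m$ such that $\mathfrak m^2=\mathfrak m$. An $R$-module $Z$ is almost zero if $\mathfrak m Z=0$. The almost $R$-modules are the objects of the quotient $\mathrm{Mod}^a_R$ of the category of $R$-modules by the Serre subcategory of almost zero modules, and $M\mapsto M^a$ denotes the quotient functor. An $R$-module $M$ is * almost flat if the functor $M^a\otimes_{R^a}-$, induced on $\mathrm{Mod}^a_R$ by $M\otimes_R-$, is exact; equivalently, if $M\otimes_R-$ sends every sequence $A\to B\to C$ of $R$-modules that becomes exact in $\mathrm{Mod}^a_R$ to a sequence that becomes exact in $\mathrm{Mod}^a_R$; * almost finitely generated if for every $s\in\mathfrak m$ there are $n\ge 0$ and an $R$-linear map $R^n\to M$ whose cokernel is killed by $s$; * almost finitely presented if for all $s,t\in\mathfrak m$ there is a complex $R^m\xrightarrow{g}R^n\xrightarrow{f}M$ with $s\,\mathrm{Coker}(f)=0$ and $t\,\mathrm{Ker}(f)\subseteq\mathrm{Im}(g)$; * almost coherent if it is almost finitely generated and every $R$-module $N$ that is almost finitely generated and satisfies $N^a\subseteq M^a$ (that is, admits an $R$-linear map $N\to M$ with almost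 zero kernel) is almost finitely presented. The ring $R$ is almost coherent if it is almost coherent as an $R$-module. An almost flat preenvelope of an $R$-module $M$ is an $R$-linear map $f\colon M\to P$ with $P$ almost flat such that for every almost flat $R$-module $P'$ the map $\mathrm{Hom}_R(P,P')\to\mathrm{Hom}_R(M,P')$, $h\mapsto h\circ f$, is surjective. Theorem. The following assertions are equivalent. 1. $R$ is an almost coherent ring. 2. Any product of almost flat $R$-modules is almost flat. 3. Any product of flat $R$-modules is almost flat. 4. Any product of projective $R$-modules is almost flat. 5. Any product of copies of $R$ is almost flat. 6. Any $R$-module has an almost flat preenvelope. -/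

import Mathlib

open scoped TensorProduct

universe u

/-! Almost mathematics over a commutative ring `R` with respect to an ideal `𝔪`.  The category of
almost modules is the quotient of `R`-modules by the Serre subcategory of almost zero modules.
The functor from modules to almost modules is exact and essentially surjective, and every
three-term exact sequence of almost modules comes, up to isomorphism, from a sequence of
`R`-modules; so exactness of almost modules is expressed below through modules. -/

section AlmostMath

variable {R : Type u} [CommRing R] (𝔪 : Ideal R)

/-- `M` is almost zero: `𝔪 M = 0`. -/
def IsAlmostZero (M : Type u) [AddCommGroup M] [Module R M] : Prop :=
  ∀ s ∈ 𝔪, ∀ x : M, s • x = 0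

/-- `f` becomes injective in almost modules: its kernel is almost zero. -/
def IsAlmostInjective {M N : Type u} [AddCommGroup M] [Module R M] [AddCommGroup N] [Module R N]
    (f : M →ₗ[R] N) : Prop :=
  IsAlmostZero 𝔪 (LinearMap.ker f)

/-- `A → B → C` becomes exact (at the middle term) in almost modules: the composite `g ∘ f` is zero
there, i.e. has almost zero image, and the almost submodules given by `ker g` and `range f` agree,
i.e. `𝔪 (ker g) ⊆ range f`. -/
def IsAlmostExact {A B C : Type u} [AddCommGroup A] [Module R A] [AddCommGroup B] [Module R B]
    [AddCommGroup C] [Module R C] (f : A →ₗ[R] B) (g : B →ₗ[R] C) : Prop :=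
  IsAlmostZero 𝔪 (LinearMap.range (g ∘ₗ f)) ∧
    ∀ s ∈ 𝔪, ∀ b ∈ LinearMap.ker g, s • b ∈ LinearMap.range f

/-- `M` is almost flat: tensoring with `M` is an exact functor on almost modules, that is, it
preserves almost exactness of sequences `A → B → C`. -/
def IsAlmostFlat (M : Type u) [AddCommGroup M] [Module R M] : Prop :=
  ∀ (A B C : Type u) [AddCommGroup A] [Module R A] [AddCommGroup B] [Module R B]
    [AddCommGroup C] [Module R C] (f : A →ₗ[R] B) (g : B →ₗ[R] C),
    IsAlmostExact 𝔪 f g → IsAlmostExact 𝔪 (f.lTensor M) (g.lTensor M)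

/-- `M` is almost finitely generated: for each `s ∈ 𝔪` there is `f : Rⁿ → M` whose cokernel is
killed by `s`. -/
def IsAlmostFG (M : Type u) [AddCommGroup M] [Module R M] : Prop :=
  ∀ s ∈ 𝔪, ∃ (n : ℕ) (f : (Fin n → R) →ₗ[R] M), ∀ x : M, s • x ∈ LinearMap.range f

/-- `M` is almost finitely presented: for all `s, t ∈ 𝔪` there is a complex `Rᵐ → Rⁿ → M` with
maps `g`, `f` such that `s` kills the cokernel of `f` and `t (ker f) ⊆ range g`. -/
def IsAlmostFP (M : Type u) [AddCommGroup M] [Module R M] : Prop :=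
  ∀ s ∈ 𝔪, ∀ t ∈ 𝔪, ∃ (m n : ℕ) (g : (Fin m → R) →ₗ[R] (Fin n → R)) (f : (Fin n → R) →ₗ[R] M),
    f ∘ₗ g = 0 ∧ (∀ x : M, s • x ∈ LinearMap.range f) ∧
      ∀ y ∈ LinearMap.ker f, t • y ∈ LinearMap.range g

/-- `M` is almost coherent: it is almost finitely generated, and every almost finitely generated
almost submodule of `M` is almost finitely presented.  An almost submodule of `M` is represented by
an almost injective linear map `N → M`; actual submodules are a special case. -/
def IsAlmostCoherent (M : Type u) [AddCommGroup M] [Module R M] : Prop :=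
  IsAlmostFG 𝔪 M ∧
    ∀ (N : Type u) [AddCommGroup N] [Module R N] (i : N →ₗ[R] M),
      IsAlmostInjective 𝔪 i → IsAlmostFG 𝔪 N → IsAlmostFP 𝔪 N

/-- The ring `R` is almost coherent if it is so as a module over itself. -/
def IsAlmostCoherentRing : Prop := IsAlmostCoherent 𝔪 R

/-- `f : M → P` is an almost flat preenvelope: `P` is almost flat, and every linear map from `M` to
an almost flat module factors (not necessarily uniquely) through `f`. -/
def IsAlmostFlatPreenvelope {M P : Type u} [AddCommGroup M] [Module R M]
    [AddCommGroup P] [Module R P] (f : M →ₗ[R] P) : Prop :=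
  IsAlmostFlat 𝔪 P ∧
    ∀ (Q : Type u) [AddCommGroup Q] [Module R Q], IsAlmostFlat 𝔪 Q →
      Function.Surjective (fun h : P →ₗ[R] Q => h ∘ₗ f)

end AlmostMath

/-! Since `𝔪 ^ 2 = 𝔪`, finitely many elements of `𝔪` may be spent, one per step, on an assertion
about all `s ∈ 𝔪`. Almost flatness is tested on injections of finite modules `N → R`
(`IsAlmostFlat.of_forall_finite`). Over an almost coherent ring such `N` is almost finitely
presented, and tensoring with finite free modules commutes with products, so products of almost flat
modules pass the test.

Conversely, flatness of a power of `R` indexed by a kernel `K ⊆ R^n` makes `K` almost finitely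
generated: the tautological family of all elements of `K` is, up to `s`, a finite sum of tensors.

Given closure under products, a preenvelope is a product over a set of almost flat modules through
which all maps from `M` to almost flat modules factor. It exists because pure submodules of almost
flat modules are almost flat and a pure submodule containing the image of `M` can be chosen of size
bounded by `R` and `M`. Conversely, a product is a retract of its own preenvelope. -/

theorem Ideal.smul_mem_of_forall_smul_smul_mem {R : Type*} [CommRing R] {𝔪 : Ideal R}
    (h𝔪 : 𝔪 ^ 2 = 𝔪) {M : Type*} [AddCommGroup M] [Module R M] (N : Submodule R M) {x : M}
    (h : ∀ s ∈ 𝔪, ∀ t ∈ 𝔪, s • t • x ∈ N) : ∀ s ∈ 𝔪, s • x ∈ N := by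
  intro s hs
  rw [← h𝔪, pow_two] at hs
  induction hs using Submodule.mul_induction_on' with
  | mem_mul_mem a ha b hb => rw [mul_smul]; exact h a ha b hb
  | add a _ b _ ha hb => rw [add_smul]; exact N.add_mem ha hb

theorem Ideal.smul_eq_zero_of_forall_smul_smul_eq_zero {R : Type*} [CommRing R] {𝔪 : Ideal R}
    (h𝔪 : 𝔪 ^ 2 = 𝔪) {M : Type*} [AddCommGroup M] [Module R M] {x : M}
    (h : ∀ s ∈ 𝔪, ∀ t ∈ 𝔪, s • t • x = 0) : ∀ s ∈ 𝔪, s • x = 0 := by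
  simpa using Ideal.smul_mem_of_forall_smul_smul_mem h𝔪 (⊥ : Submodule R M) (by simpa using h)

theorem Ideal.smul_eq_zero_of_forall_smul_smul_smul_smul_eq_zero {R : Type*} [CommRing R]
    {𝔪 : Ideal R} (h𝔪 : 𝔪 ^ 2 = 𝔪) {M : Type*} [AddCommGroup M] [Module R M] {x : M}
    (h : ∀ a ∈ 𝔪, ∀ b ∈ 𝔪, ∀ c ∈ 𝔪, ∀ d ∈ 𝔪, a • b • c • d • x = 0) : ∀ s ∈ 𝔪, s • x = 0 := by
  refine smul_eq_zero_of_forall_smul_smul_eq_zero h𝔪 fun s hs t ht => ?_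
  refine smul_eq_zero_of_forall_smul_smul_eq_zero h𝔪 (fun a ha b hb => ?_) s hs
  rw [smul_comm b, smul_comm a]
  exact smul_eq_zero_of_forall_smul_smul_eq_zero h𝔪 (fun c hc d hd => h c hc d hd a ha b hb) t ht

theorem TensorProduct.exists_sum_tmul_eq_of_span_eq_top {R M N ι : Type*} [CommRing R]
    [AddCommGroup M] [Module R M] [AddCommGroup N] [Module R N] [Fintype ι] {a : ι → N}
    (ha : Submodule.span R (Set.range a) = ⊤) (x : M ⊗[R] N) :
    ∃ q : ι → M, x = ∑ i, q i ⊗ₜ[R] a i := by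
  induction x with
  | zero => exact ⟨0, by simp⟩
  | tmul q n =>
    obtain ⟨c, rfl⟩ := (Submodule.mem_span_range_iff_exists_fun R).1
      (ha ▸ Submodule.mem_top : n ∈ Submodule.span R (Set.range a))
    exact ⟨fun i => c i • q, by simp [TensorProduct.tmul_sum, TensorProduct.smul_tmul]⟩
  | add x y hx hy =>
    obtain ⟨q, rfl⟩ := hx
    obtain ⟨q', rfl⟩ := hy
    exact ⟨q + q', by simp [TensorProduct.add_tmul, Finset.sum_add_distrib]⟩

/-- Lets elements of a product tensored with a finite free module be compared and assembled factor
by factor. -/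
theorem TensorProduct.piScalarRight_rTensor_proj {R κ ι : Type*} [CommRing R] [Fintype κ]
    [DecidableEq κ] (F : ι → Type*) [∀ i, AddCommGroup (F i)] [∀ i, Module R (F i)] (i : ι)
    (w : (∀ i, F i) ⊗[R] (κ → R)) (k : κ) :
    TensorProduct.piScalarRight R R (F i) κ
      ((LinearMap.proj i : (∀ i, F i) →ₗ[R] F i).rTensor (κ → R) w) k =
      TensorProduct.piScalarRight R R (∀ i, F i) κ w k i := by
  induction w with
  | zero => simp
  | tmul q n => simp
  | add x y hx hy => simp only [map_add, Pi.add_apply, hx, hy]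

section AlmostMath

variable {R : Type u} [CommRing R] {𝔪 : Ideal R}

/-! ### Tests for almost flatness -/

theorem isAlmostInjective_iff {M N : Type u} [AddCommGroup M] [Module R M] [AddCommGroup N]
    [Module R N] {f : M →ₗ[R] N} :
    IsAlmostInjective 𝔪 f ↔ ∀ x, f x = 0 → ∀ s ∈ 𝔪, s • x = 0 :=
  ⟨fun h x hx s hs => congrArg Subtype.val (h s hs ⟨x, hx⟩),
    fun h s hs x => Subtype.ext (h x.1 x.2 s hs)⟩

theorem IsAlmostInjective.comp (h𝔪 : 𝔪 ^ 2 = 𝔪) {A B C : Type u} [AddCommGroup A] [Module R A]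
    [AddCommGroup B] [Module R B] [AddCommGroup C] [Module R C] {g : B →ₗ[R] C} {f : A →ₗ[R] B}
    (hg : IsAlmostInjective 𝔪 g) (hf : IsAlmostInjective 𝔪 f) : IsAlmostInjective 𝔪 (g ∘ₗ f) := by
  rw [isAlmostInjective_iff] at *
  intro x hx
  refine Ideal.smul_eq_zero_of_forall_smul_smul_eq_zero h𝔪 fun s hs t ht => ?_
  exact hf _ (by rw [map_smul]; exact hg _ hx t ht) s hs

theorem isAlmostInjective_lTensor_iff_rTensor (M : Type u) [AddCommGroup M] [Module R M]
    {A B : Type u} [AddCommGroup A] [Module R A] [AddCommGroup B] [Module R B] {f : A →ₗ[R] B} :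
    IsAlmostInjective 𝔪 (f.lTensor M) ↔ IsAlmostInjective 𝔪 (f.rTensor M) := by
  have h : f.rTensor M = TensorProduct.comm R M B ∘ₗ f.lTensor M ∘ₗ TensorProduct.comm R A M := by
    ext; simp
  simp only [isAlmostInjective_iff, h, LinearMap.comp_apply, LinearEquiv.coe_coe,
    LinearEquiv.map_eq_zero_iff]
  refine ⟨fun H x hx s hs => ?_, fun H x hx s hs => ?_⟩
  · apply (TensorProduct.comm R A M).injective
    rw [map_smul, map_zero]
    exact H _ hx s hs
  · apply (TensorProduct.comm R M A).injective
    rw [map_smul, map_zero]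
    exact H _ (by simpa using hx) s hs

theorem IsAlmostFlat.isAlmostInjective_lTensor {M : Type u} [AddCommGroup M] [Module R M]
    (hM : IsAlmostFlat 𝔪 M) {A B : Type u} [AddCommGroup A] [Module R A] [AddCommGroup B]
    [Module R B] {f : A →ₗ[R] B} (hf : Function.Injective f) :
    IsAlmostInjective 𝔪 (f.lTensor M) := by
  rw [isAlmostInjective_iff]
  intro x hx s hs
  -- Exactness of `A → A → B` with first map zero encodes injectivity of `f`.
  have h := hM A A B (0 : A →ₗ[R] A) f ⟨?_, ?_⟩
  · obtain ⟨y, hy⟩ := h.2 s hs x hx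
    simpa using hy.symm
  · rintro s - ⟨_, y, rfl⟩
    ext; simp
  · intro s _ b hb
    rw [(injective_iff_map_eq_zero f).1 hf b hb]
    simp

/-- Factor `g` through its range: right exactness handles `ker g → B → range g`, and the inclusion
of the range contributes only an almost zero kernel. -/
theorem IsAlmostFlat.of_isAlmostInjective_lTensor (h𝔪 : 𝔪 ^ 2 = 𝔪) {M : Type u} [AddCommGroup M]
    [Module R M]
    (h : ∀ (A B : Type u) [AddCommGroup A] [Module R A] [AddCommGroup B] [Module R B]
      (f : A →ₗ[R] B), Function.Injective f → IsAlmostInjective 𝔪 (f.lTensor M)) :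
    IsAlmostFlat 𝔪 M := by
  intro A B C _ _ _ _ _ _ f g ⟨hgf, hker⟩
  constructor
  · rintro s hs ⟨_, y, rfl⟩
    refine Subtype.ext ?_
    have h0 : s • (g ∘ₗ f) = 0 := by
      ext a
      exact congrArg Subtype.val (hgf s hs ⟨_, a, rfl⟩)
    change s • (g.lTensor M ∘ₗ f.lTensor M) y = 0
    rw [← LinearMap.lTensor_comp, ← LinearMap.smul_apply, ← LinearMap.lTensor_smul, h0]
    simp
  · intro s hs b hb
    refine Ideal.smul_mem_of_forall_smul_smul_mem h𝔪 _ (fun s hs t ht => ?_) s hs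
    have hι := isAlmostInjective_iff.1 (h _ _ g.range.subtype g.range.injective_subtype)
      (g.rangeRestrict.lTensor M b) (by
        rw [← LinearMap.lTensor_comp_apply]; simpa using hb) t ht
    rw [← map_smul] at hι
    have hex : Function.Exact g.ker.subtype g.rangeRestrict := by
      intro y
      simp [← Subtype.val_inj]
    obtain ⟨z, hz⟩ := (lTensor_exact M hex g.surjective_rangeRestrict _).1 hι
    rw [← hz]
    clear hz
    induction z with
    | zero => simp
    | tmul m k =>
      obtain ⟨a, ha⟩ := hker s hs k k.2
      exact ⟨m ⊗ₜ a, by simp [ha]⟩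
    | add x y hx hy =>
      rw [map_add, smul_add]
      exact add_mem hx hy

/-- A tensor and the reason its image vanishes both live in finitely generated submodules. -/
theorem isAlmostInjective_lTensor_of_finite {M : Type u} [AddCommGroup M] [Module R M] {A B : Type u}
    [AddCommGroup A] [Module R A] [AddCommGroup B] [Module R B] {f : A →ₗ[R] B}
    (h : ∀ (A' : Submodule R A) (B' : Submodule R B), A'.FG → B'.FG →
      ∀ hf : A' ≤ B'.comap f, IsAlmostInjective 𝔪 ((f.restrict hf).lTensor M)) :
    IsAlmostInjective 𝔪 (f.lTensor M) := by
  rw [isAlmostInjective_lTensor_iff_rTensor, isAlmostInjective_iff]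
  intro x hx s hs
  obtain ⟨A', hA', sub⟩ := Submodule.exists_fg_le_subset_range_rTensor_subtype {x} (by simp)
  obtain ⟨x, rfl⟩ := sub rfl
  have hx0 : (A'.map f).subtype.rTensor M ((f.submoduleMap A').rTensor M x) =
      (A'.map f).subtype.rTensor M 0 := by
    rw [map_zero, ← hx, ← LinearMap.rTensor_comp_apply, ← LinearMap.rTensor_comp_apply]
    rfl
  obtain ⟨B', hB', le, eq⟩ := (hA'.map _).exists_rTensor_fg_inclusion_eq hx0
  rw [← LinearMap.rTensor_comp_apply, map_zero] at eq
  have := h A' B' hA' hB' (Submodule.map_le_iff_le_comap.mp le)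
  rw [isAlmostInjective_lTensor_iff_rTensor, isAlmostInjective_iff] at this
  rw [← map_smul, this x eq s hs, map_zero]

/-- Adjoining one generator `b` to a submodule `A` costs only the ideal `{r | r b ∈ A}`. -/
theorem isAlmostInjective_lTensor_of_sup_span_singleton {M : Type u} [AddCommGroup M] [Module R M]
    (h : ∀ J : Ideal R, IsAlmostInjective 𝔪 (J.subtype.lTensor M)) {A B : Type u}
    [AddCommGroup A] [Module R A] [AddCommGroup B] [Module R B] {f : A →ₗ[R] B}
    (hf : Function.Injective f) (b : B) (hb : f.range ⊔ Submodule.span R {b} = ⊤) :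
    IsAlmostInjective 𝔪 (f.lTensor M) := by
  let J : Ideal R := f.range.comap (LinearMap.toSpanSingleton R B b)
  let a : J →ₗ[R] A := (LinearEquiv.ofInjective f hf).symm.toLinearMap ∘ₗ
    (LinearMap.toSpanSingleton R B b).restrict (p := J) (q := f.range) (fun _ hx => hx)
  have ha (r : J) : f (a r) = (r : R) • b :=
    congrArg Subtype.val ((LinearEquiv.ofInjective f hf).apply_symm_apply _)
  -- `B` is the pushout of `A` and `R` along `J`: the sequence `J → A × R → B → 0` is exact. For `x`
  -- in the kernel, `(x, 0)` comes from `M ⊗ J`; its second coordinate shows that the lift is almost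
  -- zero, its first that `x` is.
  let k : J →ₗ[R] A × R := (-a).prod J.subtype
  let p : A × R →ₗ[R] B := f.coprod (LinearMap.toSpanSingleton R B b)
  have hp : Function.Surjective p := by
    rw [← LinearMap.range_eq_top, LinearMap.range_coprod, LinearMap.range_toSpanSingleton, hb]
  have hkp : Function.Exact k p := by
    rintro ⟨x, r⟩
    constructor
    · intro hx
      have hx : f x + r • b = 0 := hx
      have hr : r ∈ J := ⟨-x, by rw [map_neg]; exact (eq_neg_of_add_eq_zero_right hx).symm⟩
      refine ⟨⟨r, hr⟩, Prod.ext (hf ?_) rfl⟩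
      change f (-a _) = f x
      rw [map_neg, ha, eq_neg_of_add_eq_zero_left hx]
    · rintro ⟨r, hr⟩
      rw [← hr]
      change f (-a r) + (r : R) • b = 0
      rw [map_neg, ha, neg_add_cancel]
  rw [isAlmostInjective_iff]
  intro x hx s hs
  obtain ⟨z, hz⟩ := (lTensor_exact M hkp hp ((LinearMap.inl R A R).lTensor M x)).1 (by
    rw [← LinearMap.lTensor_comp_apply, LinearMap.coprod_inl, hx])
  have hz2 : J.subtype.lTensor M z = 0 := by
    have := congrArg ((LinearMap.snd R A R).lTensor M) hz
    rw [← LinearMap.lTensor_comp_apply, ← LinearMap.lTensor_comp_apply, LinearMap.snd_comp_inl,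
      LinearMap.snd_prod] at this
    simpa using this
  have hz1 : (-a).lTensor M z = x := by
    have := congrArg ((LinearMap.fst R A R).lTensor M) hz
    rw [← LinearMap.lTensor_comp_apply, ← LinearMap.lTensor_comp_apply, LinearMap.fst_comp_inl,
      LinearMap.fst_prod] at this
    simpa using this
  rw [← hz1, ← map_smul, isAlmostInjective_iff.1 (h J) z hz2 s hs, map_zero]

theorem isAlmostInjective_lTensor_of_sup_span_finset (h𝔪 : 𝔪 ^ 2 = 𝔪) {M : Type u}
    [AddCommGroup M] [Module R M]
    (h : ∀ J : Ideal R, IsAlmostInjective 𝔪 (J.subtype.lTensor M)) {B : Type u}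
    [AddCommGroup B] [Module R B] (T : Finset B) :
    ∀ {A : Type u} [AddCommGroup A] [Module R A] {f : A →ₗ[R] B}, Function.Injective f →
      f.range ⊔ Submodule.span R (T : Set B) = ⊤ → IsAlmostInjective 𝔪 (f.lTensor M) := by
  classical
  induction T using Finset.induction_on with
  | empty =>
    intro A _ _ f hf hT
    refine isAlmostInjective_lTensor_of_sup_span_singleton h hf 0 ?_
    simpa using hT
  | insert b T _ ih =>
    intro A _ _ f hf hT
    let A' := f.range ⊔ Submodule.span R {b}
    have hfA (x : A) : f x ∈ A' := Submodule.mem_sup_left ⟨x, rfl⟩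
    have hbA : b ∈ A' := Submodule.mem_sup_right (Submodule.mem_span_singleton_self b)
    let f' : A →ₗ[R] A' := f.codRestrict A' hfA
    have hcomp : f = A'.subtype ∘ₗ f' := rfl
    rw [hcomp, LinearMap.lTensor_comp]
    refine IsAlmostInjective.comp h𝔪 (ih A'.injective_subtype ?_)
      (isAlmostInjective_lTensor_of_sup_span_singleton h (b := ⟨b, hbA⟩) ?_ ?_)
    · rw [Submodule.range_subtype, ← hT, Finset.coe_insert, Submodule.span_insert, sup_assoc]
    · exact fun x y hxy => hf (congrArg Subtype.val hxy)
    · apply Submodule.map_injective_of_injective A'.injective_subtype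
      rw [Submodule.map_sup, Submodule.map_span, ← LinearMap.range_comp, ← hcomp]
      simp [A']

/-- An analogue of the ideal criterion for flatness: finitely generated ideals give all ideals,
these give one-generator extensions, and finitely many extensions suffice after reduction to a
finite target. -/
theorem IsAlmostFlat.of_forall_finite (h𝔪 : 𝔪 ^ 2 = 𝔪) {M : Type u} [AddCommGroup M] [Module R M]
    (h : ∀ (N : Type u) [AddCommGroup N] [Module R N] [Module.Finite R N] (j : N →ₗ[R] R),
      Function.Injective j → IsAlmostInjective 𝔪 (j.lTensor M)) : IsAlmostFlat 𝔪 M := by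
  have hJ (J : Ideal R) : IsAlmostInjective 𝔪 (J.subtype.lTensor M) := by
    rw [isAlmostInjective_lTensor_iff_rTensor, isAlmostInjective_iff]
    intro x hx s hs
    obtain ⟨A', hA', sub⟩ := Submodule.exists_fg_le_subset_range_rTensor_subtype {x} (by simp)
    obtain ⟨x, rfl⟩ := sub rfl
    have := Module.Finite.iff_fg.2 hA'
    have := h A' (J.subtype ∘ₗ A'.subtype) (J.injective_subtype.comp A'.injective_subtype)
    rw [isAlmostInjective_lTensor_iff_rTensor, isAlmostInjective_iff] at this
    rw [← map_smul, this x (by rw [LinearMap.rTensor_comp_apply, hx]) s hs, map_zero]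
  refine .of_isAlmostInjective_lTensor h𝔪 fun A B _ _ _ _ f hf => ?_
  refine isAlmostInjective_lTensor_of_finite fun A' B' _ hB' le => ?_
  obtain ⟨T, hT⟩ := (Module.Finite.iff_fg.2 hB').fg_top
  refine isAlmostInjective_lTensor_of_sup_span_finset h𝔪 hJ T ?_ (by rw [hT, sup_top_eq])
  exact fun x y hxy => Subtype.ext (hf (congrArg Subtype.val hxy))

theorem IsAlmostFlat.of_flat (h𝔪 : 𝔪 ^ 2 = 𝔪) (M : Type u) [AddCommGroup M] [Module R M]
    [Module.Flat R M] : IsAlmostFlat 𝔪 M := by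
  refine .of_isAlmostInjective_lTensor h𝔪 fun A B _ _ _ _ f hf => ?_
  rw [isAlmostInjective_iff]
  intro x hx s _
  rw [(injective_iff_map_eq_zero _).1 (Module.Flat.lTensor_preserves_injective_linearMap f hf) x hx,
    smul_zero]

theorem IsAlmostFlat.of_retract (h𝔪 : 𝔪 ^ 2 = 𝔪) {M P : Type u} [AddCommGroup M] [Module R M]
    [AddCommGroup P] [Module R P] (hP : IsAlmostFlat 𝔪 P) (i : M →ₗ[R] P) (r : P →ₗ[R] M)
    (h : r ∘ₗ i = LinearMap.id) : IsAlmostFlat 𝔪 M := by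
  refine .of_isAlmostInjective_lTensor h𝔪 fun A B _ _ _ _ f hf => ?_
  rw [isAlmostInjective_iff]
  intro x hx s hs
  have h1 := isAlmostInjective_iff.1 (hP.isAlmostInjective_lTensor hf) (i.rTensor A x) (by
    rw [← LinearMap.comp_apply, LinearMap.lTensor_comp_rTensor, ← LinearMap.rTensor_comp_lTensor,
      LinearMap.comp_apply, hx, map_zero]) s hs
  have h2 := congrArg (r.rTensor A) h1
  rw [map_smul, ← LinearMap.rTensor_comp_apply, h] at h2
  simpa using h2

/-! ### Almost coherence and products -/

theorem IsAlmostCoherentRing.isAlmostFlat_pi (h𝔪 : 𝔪 ^ 2 = 𝔪) (hR : IsAlmostCoherentRing 𝔪)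
    {ι : Type u} (F : ι → Type u) [∀ i, AddCommGroup (F i)] [∀ i, Module R (F i)]
    (hF : ∀ i, IsAlmostFlat 𝔪 (F i)) : IsAlmostFlat 𝔪 (∀ i, F i) := by
  refine .of_forall_finite h𝔪 fun N _ _ _ j hj => ?_
  have hN : IsAlmostFP 𝔪 N := by
    refine hR.2 N j ?_ fun s _ => ?_
    · rw [isAlmostInjective_iff]
      intro x hx s _
      rw [(injective_iff_map_eq_zero j).1 hj x hx, smul_zero]
    · obtain ⟨n, f, hf⟩ := Module.Finite.exists_fin' R N
      exact ⟨n, f, fun x => hf _⟩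
  rw [isAlmostInjective_iff]
  intro z hz
  -- Here `s` lifts `z` along `f`, `r` kills the projections of `z`, `u` lifts from `ker f` tensored
  -- with `F i`, and `t` moves `ker f` into the range of `g`.
  refine Ideal.smul_eq_zero_of_forall_smul_smul_smul_smul_eq_zero h𝔪 fun t ht u hu r hr s hs => ?_
  obtain ⟨m, n, g, f, hfg, hs, ht⟩ := hN s hs t ht
  obtain ⟨w, hw⟩ : ∃ w, f.lTensor (∀ i, F i) w = s • z := by
    clear hz
    induction z with
    | zero => exact ⟨0, by simp⟩
    | tmul p a =>
      obtain ⟨y, hy⟩ := hs a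
      exact ⟨p ⊗ₜ y, by simp [hy]⟩
    | add x y hx hy =>
      obtain ⟨v, hv⟩ := hx
      obtain ⟨w, hw⟩ := hy
      exact ⟨v + w, by rw [map_add, hv, hw, smul_add]⟩
  have hv (i : ι) : ∃ v, g.lTensor (F i) v =
      t • u • r • (LinearMap.proj i : (∀ i, F i) →ₗ[R] F i).rTensor _ w := by
    have h0 : f.lTensor (F i) (r • (LinearMap.proj i : (∀ i, F i) →ₗ[R] F i).rTensor _ w) = 0 := by
      have hzi := isAlmostInjective_iff.1 ((hF i).isAlmostInjective_lTensor hj)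
        ((LinearMap.proj i : (∀ i, F i) →ₗ[R] F i).rTensor _ z) (by
          rw [← LinearMap.comp_apply, LinearMap.lTensor_comp_rTensor,
            ← LinearMap.rTensor_comp_lTensor, LinearMap.comp_apply, hz, map_zero]) r hr
      rw [map_smul, ← LinearMap.comp_apply, LinearMap.lTensor_comp_rTensor,
            ← LinearMap.rTensor_comp_lTensor, LinearMap.comp_apply, hw, map_smul, smul_comm, hzi,
            smul_zero]
    obtain ⟨y, hy⟩ := (hF i _ _ _ f.ker.subtype f ⟨by
        rintro s - ⟨_, y, rfl⟩
        ext
        simp, fun s _ b hb => ⟨s • ⟨b, hb⟩, rfl⟩⟩).2 u hu _ h0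
    rw [← hy]
    clear hy h0
    induction y with
    | zero => exact ⟨0, by simp⟩
    | tmul p a =>
      obtain ⟨y, hy⟩ := ht a a.2
      exact ⟨p ⊗ₜ y, by simp [hy]⟩
    | add x y hx hy =>
      obtain ⟨v, hv⟩ := hx
      obtain ⟨w, hw⟩ := hy
      exact ⟨v + w, by rw [map_add, hv, hw, map_add, smul_add]⟩
  choose v hv using hv
  -- The lifts `v i` were chosen independently; since `R^m` is finite free they form a single tensor
  -- over the product.
  have hgv : g.lTensor (∀ i, F i) ((TensorProduct.piScalarRight R R (∀ i, F i) (Fin m)).symm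
      fun k i => TensorProduct.piScalarRight R R (F i) (Fin m) (v i) k) = t • u • r • w := by
    apply (TensorProduct.piScalarRight R R (∀ i, F i) (Fin n)).injective
    ext k i
    rw [← TensorProduct.piScalarRight_rTensor_proj, ← TensorProduct.piScalarRight_rTensor_proj,
      ← LinearMap.comp_apply, LinearMap.rTensor_comp_lTensor, ← LinearMap.lTensor_comp_rTensor,
      LinearMap.comp_apply, LinearMap.map_smul, LinearMap.map_smul, LinearMap.map_smul, ← hv]
    refine congrArg (fun x => TensorProduct.piScalarRight R R (F i) (Fin n) (g.lTensor (F i) x) k) ?_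
    apply (TensorProduct.piScalarRight R R (F i) (Fin m)).injective
    ext l
    rw [TensorProduct.piScalarRight_rTensor_proj, LinearEquiv.apply_symm_apply]
  rw [← hw, ← map_smul, ← map_smul, ← map_smul, ← hgv, ← LinearMap.lTensor_comp_apply, hfg,
    LinearMap.lTensor_zero, LinearMap.zero_apply]

theorem exists_fg_le_ker_of_isAlmostFlat_pi {n : ℕ} (q : (Fin n → R) →ₗ[R] R)
    (h : IsAlmostFlat 𝔪 (q.ker → R)) {s : R} (hs : s ∈ 𝔪) :
    ∃ L ≤ q.ker, L.FG ∧ ∀ x ∈ q.ker, s • x ∈ L := by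
  -- The tautological tensor: its component at `k` is `k` itself, so `q` kills it. A lift of `s • w`
  -- involves finitely many kernel elements, and these span `L`.
  let w : (q.ker → R) ⊗[R] (Fin n → R) := ∑ j, (fun k => k.1 j) ⊗ₜ Pi.single j 1
  have hw (k : q.ker) : TensorProduct.lid R _
      ((LinearMap.proj k : (q.ker → R) →ₗ[R] R).rTensor _ w) = k := by
    ext i
    simp [w, Pi.single_apply]
  have hqw : q.lTensor (q.ker → R) w = 0 := by
    apply (TensorProduct.rid R (q.ker → R)).injective
    ext k
    have := congrArg q (hw k)
    rw [LinearMap.mem_ker.1 k.2] at this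
    rw [map_zero, Pi.zero_apply, ← this]
    simp [w, mul_comm]
  obtain ⟨y, hy⟩ := (h _ _ _ q.ker.subtype q ⟨by
    rintro s - ⟨_, y, rfl⟩
    ext
    simp, fun s _ b hb => ⟨s • ⟨b, hb⟩, rfl⟩⟩).2 s hs w hqw
  obtain ⟨l, a, k, rfl⟩ := TensorProduct.exists_sum_tmul_eq y
  refine ⟨Submodule.span R (Set.range fun i => (k i : Fin n → R)), ?_,
    Submodule.fg_span (Set.finite_range _), fun x hx => ?_⟩
  · rw [Submodule.span_le]
    rintro _ ⟨i, rfl⟩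
    exact (k i).2
  · have := congrArg (fun z => TensorProduct.lid R _
      ((LinearMap.proj (⟨x, hx⟩ : q.ker) : (q.ker → R) →ₗ[R] R).rTensor _ z)) hy
    simp only [map_smul, hw] at this
    rw [← this]
    simp only [map_sum, LinearMap.lTensor_tmul, LinearMap.rTensor_tmul, TensorProduct.lid_tmul]
    exact Submodule.sum_mem _ fun i _ => Submodule.smul_mem _ _ (Submodule.subset_span ⟨i, rfl⟩)

theorem isAlmostCoherentRing_of_isAlmostFlat_pi (h𝔪 : 𝔪 ^ 2 = 𝔪)
    (h : ∀ ι : Type u, IsAlmostFlat 𝔪 (ι → R)) : IsAlmostCoherentRing 𝔪 := by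
  refine ⟨fun s _ => ⟨1, LinearMap.proj 0, fun x => ⟨fun _ => s • x, rfl⟩⟩,
    fun N _ _ i hi hN s hs t ht => ?_⟩
  obtain ⟨n, f, hf⟩ := hN s hs
  obtain ⟨L, hL, hfg, ht⟩ : ∃ L ≤ f.ker, L.FG ∧ ∀ x ∈ f.ker, t • x ∈ L := by
    -- Only the kernel of `i ∘ f` is controlled, and it may exceed `ker f`. Splitting `t` into
    -- products `a * b`, `b` gives a finitely generated submodule and `a` pushes it into `ker f`, as
    -- `i` is almost injective.
    rw [← h𝔪, pow_two] at ht
    induction ht using Submodule.mul_induction_on' with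
    | mem_mul_mem a ha b hb =>
      obtain ⟨L, hL, hfg, hb⟩ := exists_fg_le_ker_of_isAlmostFlat_pi (i ∘ₗ f) (h _) hb
      refine ⟨L.map (LinearMap.lsmul R _ a), ?_, hfg.map _, fun x hx => ?_⟩
      · rintro _ ⟨y, hy, rfl⟩
        change f (a • y) = 0
        rw [map_smul]
        exact isAlmostInjective_iff.1 hi _ (hL hy) a ha
      · exact ⟨b • x, hb x (by rw [LinearMap.mem_ker, LinearMap.comp_apply, hx, map_zero]),
          (mul_smul a b x).symm⟩
    | add a _ b _ ha hb =>
      obtain ⟨L, hL, hfg, ha⟩ := ha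
      obtain ⟨L', hL', hfg', hb⟩ := hb
      refine ⟨L ⊔ L', sup_le hL hL', hfg.sup hfg', fun x hx => ?_⟩
      rw [add_smul]
      exact Submodule.add_mem_sup (ha x hx) (hb x hx)
  obtain ⟨m, g, rfl⟩ := (Submodule.fg_iff_exists_fin_linearMap R _).1 hfg
  exact ⟨m, n, g, f, LinearMap.range_le_ker_iff.1 hL, hf, ht⟩

/-! ### Pure submodules of bounded size -/

/-- A submodule in which every finite linear system solvable in the ambient module is solvable. -/
def Submodule.IsPureSubmodule {Q : Type u} [AddCommGroup Q] [Module R Q] (S : Submodule R Q) :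
    Prop :=
  ∀ (m n : ℕ) (A : Fin m → Fin n → R) (b : Fin m → S),
    (∃ y : Fin n → Q, ∀ i, (b i : Q) = ∑ j, A i j • y j) →
      ∃ y : Fin n → S, ∀ i, b i = ∑ j, A i j • y j

/-- By the equational criterion, vanishing of a tensor is witnessed by a finite linear system solved
in `Q`; purity moves the solution into `S`. -/
theorem Submodule.IsPureSubmodule.rTensor_injective {Q : Type u} [AddCommGroup Q] [Module R Q]
    {S : Submodule R Q} (hS : S.IsPureSubmodule) (N : Type u) [AddCommGroup N] [Module R N]
    [Module.Finite R N] : Function.Injective (S.subtype.rTensor N) := by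
  rw [injective_iff_map_eq_zero]
  intro x hx
  obtain ⟨n, a, ha⟩ := Module.Finite.exists_fin (R := R) (M := N)
  obtain ⟨q, rfl⟩ := TensorProduct.exists_sum_tmul_eq_of_span_eq_top ha x
  have hx' : ∑ i, a i ⊗ₜ[R] (q i : Q) = 0 := by
    simpa using congrArg (TensorProduct.comm R Q N) hx
  obtain ⟨k, A, y, h1, h2⟩ := TensorProduct.vanishesTrivially_of_sum_tmul_eq_zero R ha hx'
  obtain ⟨y, hy⟩ := hS n k A q ⟨y, h1⟩
  have := TensorProduct.sum_tmul_eq_zero_of_vanishesTrivially R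
    (⟨k, A, y, hy, h2⟩ : TensorProduct.VanishesTrivially R a q)
  simpa using congrArg (TensorProduct.comm R N S) this

theorem IsAlmostFlat.of_isPureSubmodule (h𝔪 : 𝔪 ^ 2 = 𝔪) {Q : Type u} [AddCommGroup Q]
    [Module R Q] (hQ : IsAlmostFlat 𝔪 Q) {S : Submodule R Q} (hS : S.IsPureSubmodule) :
    IsAlmostFlat 𝔪 S := by
  refine .of_forall_finite h𝔪 fun N _ _ _ j hj => ?_
  rw [isAlmostInjective_iff]
  intro x hx s hs
  apply hS.rTensor_injective N
  rw [map_smul, map_zero]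
  refine isAlmostInjective_iff.1 (hQ.isAlmostInjective_lTensor hj) _ ?_ s hs
  rw [← LinearMap.comp_apply, LinearMap.lTensor_comp_rTensor, ← LinearMap.rTensor_comp_lTensor,
      LinearMap.comp_apply, hx, map_zero]

/-- Terms naming the elements of the closure of the image of `M` in a module under solving finite
linear systems over `R`. -/
inductive SolutionTerm (R M : Type u) : Type u
  | of (x : M) : SolutionTerm R M
  | zero : SolutionTerm R M
  | add (a b : SolutionTerm R M) : SolutionTerm R M
  | smul (r : R) (a : SolutionTerm R M) : SolutionTerm R M
  | solve (m n : ℕ) (A : Fin m → Fin n → R) (b : Fin m → SolutionTerm R M) (j : Fin n) :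
      SolutionTerm R M

namespace SolutionTerm

variable {M Q : Type u} [AddCommGroup M] [Module R M] [AddCommGroup Q] [Module R Q]

open Classical in
/-- The element of `Q` named by a term, for a map `φ : M → Q`. -/
noncomputable def eval (φ : M →ₗ[R] Q) : SolutionTerm R M → Q
  | of x => φ x
  | zero => 0
  | add a b => eval φ a + eval φ b
  | smul r a => r • eval φ a
  | solve _ n A b j =>
    -- One solution is chosen for all `j` at once, so the components fit together; unsolvable
    -- systems get the junk value `0`.
    if h : ∃ y : Fin n → Q, ∀ i, eval φ (b i) = ∑ j, A i j • y j then h.choose j else 0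

/-- The submodule of all elements named by terms. -/
noncomputable def closure (φ : M →ₗ[R] Q) : Submodule R Q where
  carrier := Set.range (eval φ)
  zero_mem' := ⟨zero, rfl⟩
  add_mem' := by
    rintro _ _ ⟨a, rfl⟩ ⟨b, rfl⟩
    exact ⟨add a b, rfl⟩
  smul_mem' := by
    rintro r _ ⟨a, rfl⟩
    exact ⟨smul r a, rfl⟩

theorem isPureSubmodule_closure (φ : M →ₗ[R] Q) : (closure φ).IsPureSubmodule := by
  intro m n A b h
  choose t ht using fun i => (b i).2
  simp only [← ht] at h
  have he (j : Fin n) : eval φ (solve m n A t j) = h.choose j := by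
    rw [eval, dif_pos h]
  refine ⟨fun j => ⟨h.choose j, _, he j⟩, fun i => Subtype.ext ?_⟩
  simpa [ht] using h.choose_spec i

end SolutionTerm

/-! ### Almost flat preenvelopes -/

theorem isAlmostFlatPreenvelope_pi {M ι : Type u} {F : ι → Type u} [AddCommGroup M] [Module R M]
    [∀ i, AddCommGroup (F i)] [∀ i, Module R (F i)] (a : ∀ i, M →ₗ[R] F i)
    (hF : IsAlmostFlat 𝔪 (∀ i, F i))
    (ha : ∀ (Q : Type u) [AddCommGroup Q] [Module R Q], IsAlmostFlat 𝔪 Q → ∀ φ : M →ₗ[R] Q,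
      ∃ (i : ι) (b : F i →ₗ[R] Q), b ∘ₗ a i = φ) :
    IsAlmostFlatPreenvelope 𝔪 (LinearMap.pi a) := by
  refine ⟨hF, fun Q _ _ hQ φ => ?_⟩
  obtain ⟨i, b, rfl⟩ := ha Q hQ φ
  exact ⟨b ∘ₗ LinearMap.proj i, rfl⟩

/-- Quotients of one fixed `X`, together with the maps from `M` to them, form a type in universe
`u`, so their product is available. -/
theorem exists_isAlmostFlatPreenvelope_of_quotients
    (h : ∀ (ι : Type u) (F : ι → Type u) [∀ i, AddCommGroup (F i)] [∀ i, Module R (F i)],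
        (∀ i, IsAlmostFlat 𝔪 (F i)) → IsAlmostFlat 𝔪 (∀ i, F i))
    (M X : Type u) [AddCommGroup M] [Module R M] [AddCommGroup X] [Module R X]
    (hX : ∀ (Q : Type u) [AddCommGroup Q] [Module R Q], IsAlmostFlat 𝔪 Q → ∀ φ : M →ₗ[R] Q,
      ∃ (K : Submodule R X) (a : M →ₗ[R] X ⧸ K) (b : (X ⧸ K) →ₗ[R] Q),
        IsAlmostFlat 𝔪 (X ⧸ K) ∧ b ∘ₗ a = φ) :
    ∃ (P : Type u) (_ : AddCommGroup P) (_ : Module R P) (f : M →ₗ[R] P),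
      IsAlmostFlatPreenvelope 𝔪 f := by
  let ι : Type u := Σ K : {K : Submodule R X // IsAlmostFlat 𝔪 (X ⧸ K)}, M →ₗ[R] X ⧸ K.1
  let F (i : ι) : Type u := X ⧸ i.1.1
  let (i : ι) : AddCommGroup (F i) := inferInstanceAs (AddCommGroup (X ⧸ i.1.1))
  let (i : ι) : Module R (F i) := inferInstanceAs (Module R (X ⧸ i.1.1))
  let a (i : ι) : M →ₗ[R] F i := i.2
  refine ⟨∀ i, F i, inferInstance, inferInstance, LinearMap.pi a,
    isAlmostFlatPreenvelope_pi a (h ι F fun i => i.1.2) fun Q _ _ hQ φ => ?_⟩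
  obtain ⟨K, a, b, hK, rfl⟩ := hX Q hQ φ
  exact ⟨⟨⟨K, hK⟩, a⟩, b, rfl⟩

open SolutionTerm in
theorem exists_isAlmostFlatPreenvelope (h𝔪 : 𝔪 ^ 2 = 𝔪)
    (h : ∀ (ι : Type u) (F : ι → Type u) [∀ i, AddCommGroup (F i)] [∀ i, Module R (F i)],
        (∀ i, IsAlmostFlat 𝔪 (F i)) → IsAlmostFlat 𝔪 (∀ i, F i))
    (M : Type u) [AddCommGroup M] [Module R M] :
    ∃ (P : Type u) (_ : AddCommGroup P) (_ : Module R P) (f : M →ₗ[R] P),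
      IsAlmostFlatPreenvelope 𝔪 f := by
  -- The free module on terms does not depend on `Q` or `φ`, yet surjects onto every closure.
  refine exists_isAlmostFlatPreenvelope_of_quotients h M (SolutionTerm R M →₀ R)
    fun Q _ _ hQ φ => ?_
  let p : (SolutionTerm R M →₀ R) →ₗ[R] closure φ :=
    Finsupp.linearCombination R fun t => ⟨eval φ t, t, rfl⟩
  have hp : Function.Surjective p := by
    rintro ⟨_, t, rfl⟩
    exact ⟨Finsupp.single t 1, by simp [p]⟩
  let e := p.quotKerEquivOfSurjective hp
  refine ⟨p.ker, e.symm.toLinearMap ∘ₗ φ.codRestrict _ fun x => ⟨of x, rfl⟩,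
    (closure φ).subtype ∘ₗ e.toLinearMap, ?_, ?_⟩
  · exact (hQ.of_isPureSubmodule h𝔪 (isPureSubmodule_closure φ)).of_retract h𝔪 e.toLinearMap
      e.symm.toLinearMap (LinearMap.ext e.symm_apply_apply)
  · ext x
    simp only [LinearMap.comp_apply, LinearEquiv.coe_coe, LinearEquiv.apply_symm_apply]
    rfl

theorem isAlmostFlat_pi_of_exists_isAlmostFlatPreenvelope (h𝔪 : 𝔪 ^ 2 = 𝔪)
    (h : ∀ (M : Type u) [AddCommGroup M] [Module R M],
      ∃ (P : Type u) (_ : AddCommGroup P) (_ : Module R P) (f : M →ₗ[R] P),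
        IsAlmostFlatPreenvelope 𝔪 f)
    {ι : Type u} (F : ι → Type u) [∀ i, AddCommGroup (F i)] [∀ i, Module R (F i)]
    (hF : ∀ i, IsAlmostFlat 𝔪 (F i)) : IsAlmostFlat 𝔪 (∀ i, F i) := by
  obtain ⟨P, _, _, f, hP, hf⟩ := h (∀ i, F i)
  -- The projections factor through the preenvelope and together form a retraction onto the product.
  choose r hr using fun i => hf (F i) (hF i) (LinearMap.proj i)
  refine hP.of_retract h𝔪 f (LinearMap.pi r) ?_
  refine LinearMap.ext fun x => funext fun i => ?_
  exact LinearMap.congr_fun (hr i) x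

end AlmostMath

theorem mainTheorem1 (R : Type u) [CommRing R] (𝔪 : Ideal R) (h𝔪 : 𝔪 ^ 2 = 𝔪) :
    List.TFAE [
      IsAlmostCoherentRing 𝔪,
      ∀ (ι : Type u) (F : ι → Type u) [∀ i, AddCommGroup (F i)] [∀ i, Module R (F i)],
        (∀ i, IsAlmostFlat 𝔪 (F i)) → IsAlmostFlat 𝔪 (∀ i, F i),
      ∀ (ι : Type u) (F : ι → Type u) [∀ i, AddCommGroup (F i)] [∀ i, Module R (F i)],
        (∀ i, Module.Flat R (F i)) → IsAlmostFlat 𝔪 (∀ i, F i),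
      ∀ (ι : Type u) (F : ι → Type u) [∀ i, AddCommGroup (F i)] [∀ i, Module R (F i)],
        (∀ i, Module.Projective R (F i)) → IsAlmostFlat 𝔪 (∀ i, F i),
      ∀ ι : Type u, IsAlmostFlat 𝔪 (ι → R),
      ∀ (M : Type u) [AddCommGroup M] [Module R M],
        ∃ (P : Type u) (_ : AddCommGroup P) (_ : Module R P) (f : M →ₗ[R] P),
          IsAlmostFlatPreenvelope 𝔪 f] := by
  tfae_have 1 → 2 := fun h ι F _ _ hF => h.isAlmostFlat_pi h𝔪 F hF
  tfae_have 2 → 3 := fun h ι F _ _ hF => h ι F fun i => .of_flat h𝔪 (F i)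
  tfae_have 3 → 4 := fun h ι F _ _ hF => h ι F fun i => inferInstance
  tfae_have 4 → 5 := fun h ι => h ι (fun _ => R) fun _ => inferInstance
  tfae_have 5 → 1 := isAlmostCoherentRing_of_isAlmostFlat_pi h𝔪
  tfae_have 2 → 6 := exists_isAlmostFlatPreenvelope h𝔪
  tfae_have 6 → 2 := fun h ι F _ _ hF =>
    isAlmostFlat_pi_of_exists_isAlmostFlatPreenvelope h𝔪 h F hF
  tfae_finish
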